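/- Let $n\ge 0$, let $A=\mathrm{diag}(\lambda_1,\dots,\lambda_n)$ be a complex diagonal matrix, $\lambda=(\lambda_1,\dots,\lambda_n)$, and let $X=(X_1,\dots,X_n)\in\mathbb{C}[[x_1,\dots,x_n]]^n$ be a vector of formal power series without constant or linear terms. Write $\langle\lambda,\alpha\rangle=\sum_i\lambda_i\alpha_i$. For a formal vector field $F=(F_1,\dots,F_n)$ over $\mathbb{C}[[x_1,\dots,x_n]]$, an element $g$ of $\mathbb{C}[[x_1,\dots,x_n]]$, or a Laurent monomial $g=x^\alpha=x_1^{\alpha_1}\cdots x_n^{\alpha_n}$ with $\alpha\in\mathbb{Z}^n$, is called a first integral of $\dot x=F(x)$ if $\sum_{i=1}^n F_i\,\partial g/\partial x_i=0$ (constants are allowed). Formal power series $f_1,\dots,f_p$ are functionally independent if the Jacobian matrix $(\partial f_j/\partial x_i)$ has rank $p$ over the field of fractions of $\mathbb{C}[[x_1,\dots,x_n]]$. Let $\phi:\mathbb{Z}^n\to\mathbb{C}$, $\phi(x)=\langle\lambda,x\rangle$, and let $\mathcal{R}_\lambda\subseteq\mathbb{Z}^n$ be the $\mathbb{Z}$-submodule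 spanned by $\mathcal{M}_\lambda=\{\alpha\in\mathbb{N}_0^n:\langle\lambda,\alpha\rangle=0\}$. Suppose that $$\operatorname{rank}\ker\phi=\operatorname{rank}\mathcal{R}_\lambda=p,$$ and that the system $\dot x=Ax+X(x)$ is in Poincaré–Dulac normal form, i.e. whenever a monomial $x^\alpha$, $\alpha\in\mathbb{N}_0^n$, occurs with nonzero coefficient in $X_k$, one has $\langle\lambda,\alpha\rangle=\lambda_k$. Then the system $\dot x=Ax+X(x)$ admits $p$ functionally independent formal first integrals (that is, first integrals in $\mathbb{C}[[x_1,\dots,x_n]]$) if and only if every Laurent monomial $x^\alpha$, $\alpha\in\mathbb{Z}^n$, that is a first integral of the linear system $\dot x=Ax$ is also a first integral of $\dot x=Ax+X(x)$. -/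

import Mathlib

noncomputable section

namespace FormalSystem

open scoped BigOperators

/-- The unique extension of a derivation `D` of an integral domain `R` to its field of fractions:
`D (a / b) = (b * D a - a * D b) / b ^ 2`. This is the underlying function, computed from a chosen
numerator and denominator; see `fracDerivFun_div` for the independence of the choice. -/
def fracDerivFun {R : Type*} [CommRing R] [IsDomain R] [Algebra ℂ R]
    (D : Derivation ℂ R R) (g : FractionRing R) : FractionRing R :=
  let a : R := (IsLocalization.sec (nonZeroDivisors R) g).1
  let b : R := ((IsLocalization.sec (nonZeroDivisors R) g).2 : R)
  (algebraMap R (FractionRing R) (b * D a - a * D b)) / (algebraMap R (FractionRing R) b) ^ 2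

theorem fracDerivFun_div {R : Type*} [CommRing R] [IsDomain R] [Algebra ℂ R]
    (D : Derivation ℂ R R) (a b : R) (hb : b ≠ 0) :
    fracDerivFun D (algebraMap R (FractionRing R) a / algebraMap R (FractionRing R) b) =
      algebraMap R (FractionRing R) (b * D a - a * D b) /
        (algebraMap R (FractionRing R) b) ^ 2 := by
  unfold fracDerivFun
  set g := algebraMap R (FractionRing R) a / algebraMap R (FractionRing R) b with hg
  have hsec := IsLocalization.sec_spec (nonZeroDivisors R) g
  set c : R := (IsLocalization.sec (nonZeroDivisors R) g).1
  have hd0 : ((IsLocalization.sec (nonZeroDivisors R) g).2 : R) ≠ 0 :=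
    nonZeroDivisors.ne_zero (IsLocalization.sec (nonZeroDivisors R) g).2.2
  set d : R := ((IsLocalization.sec (nonZeroDivisors R) g).2 : R)
  have hb' : algebraMap R (FractionRing R) b ≠ 0 := by
    simpa using hb
  have hd' : algebraMap R (FractionRing R) d ≠ 0 := by
    simpa using hd0
  have h1 : a * d = c * b := by
    apply IsFractionRing.injective R (FractionRing R)
    rw [map_mul, map_mul, ← hsec, hg]
    field_simp
  have h2 : a * D d + d * D a = c * D b + b * D c := by
    have := congrArg D h1
    simpa [Derivation.leibniz] using this
  simp only
  rw [div_eq_div_iff (pow_ne_zero 2 hd') (pow_ne_zero 2 hb'), ← map_pow, ← map_pow, ← map_mul,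
    ← map_mul]
  congr 1
  linear_combination (-b * d) * h2 + (b * D d + d * D b) * h1

/-- The unique extension of a derivation of an integral domain to its field of fractions. -/
def fracDeriv {R : Type*} [CommRing R] [IsDomain R] [Algebra ℂ R]
    (D : Derivation ℂ R R) : Derivation ℂ (FractionRing R) (FractionRing R) :=
  Derivation.mk'
    { toFun := fracDerivFun D
      map_add' := by
        intro x y
        obtain ⟨a, b, hb, rfl⟩ := IsFractionRing.div_surjective (A := R) x
        obtain ⟨c, d, hd, rfl⟩ := IsFractionRing.div_surjective (A := R) y
        have hb0 := nonZeroDivisors.ne_zero hb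
        have hd0 := nonZeroDivisors.ne_zero hd
        have hb' : algebraMap R (FractionRing R) b ≠ 0 := by simpa using hb0
        have hd' : algebraMap R (FractionRing R) d ≠ 0 := by simpa using hd0
        have h : algebraMap R (FractionRing R) a / algebraMap R (FractionRing R) b +
            algebraMap R (FractionRing R) c / algebraMap R (FractionRing R) d =
            algebraMap R (FractionRing R) (a * d + b * c) /
              algebraMap R (FractionRing R) (b * d) := by
          simp only [map_add, map_mul]
          field_simp
        rw [h, fracDerivFun_div D _ _ (mul_ne_zero hb0 hd0), fracDerivFun_div D _ _ hb0,
          fracDerivFun_div D _ _ hd0]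
        simp only [map_add, map_mul, map_sub, Derivation.leibniz, smul_eq_mul]
        field_simp
        ring
      map_smul' := by
        intro r x
        obtain ⟨a, b, hb, rfl⟩ := IsFractionRing.div_surjective (A := R) x
        have hb0 := nonZeroDivisors.ne_zero hb
        have hsm (u : R) : algebraMap R (FractionRing R) (r • u) =
            r • algebraMap R (FractionRing R) u := by
          rw [Algebra.smul_def, map_mul, ← IsScalarTower.algebraMap_apply, ← Algebra.smul_def]
        have h : r • (algebraMap R (FractionRing R) a / algebraMap R (FractionRing R) b) =
            algebraMap R (FractionRing R) (r • a) / algebraMap R (FractionRing R) b := by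
          rw [hsm, smul_div_assoc]
        rw [h, fracDerivFun_div D _ _ hb0, fracDerivFun_div D _ _ hb0, Derivation.map_smul,
          mul_smul_comm, smul_mul_assoc, ← smul_sub, RingHom.id_apply, hsm, smul_div_assoc] }
    (by
      intro x y
      obtain ⟨a, b, hb, rfl⟩ := IsFractionRing.div_surjective (A := R) x
      obtain ⟨c, d, hd, rfl⟩ := IsFractionRing.div_surjective (A := R) y
      have hb0 := nonZeroDivisors.ne_zero hb
      have hd0 := nonZeroDivisors.ne_zero hd
      have hb' : algebraMap R (FractionRing R) b ≠ 0 := by simpa using hb0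
      have hd' : algebraMap R (FractionRing R) d ≠ 0 := by simpa using hd0
      have h : algebraMap R (FractionRing R) a / algebraMap R (FractionRing R) b *
          (algebraMap R (FractionRing R) c / algebraMap R (FractionRing R) d) =
          algebraMap R (FractionRing R) (a * c) /
            algebraMap R (FractionRing R) (b * d) := by
        simp only [map_mul]
        field_simp
      change fracDerivFun D _ = _ • fracDerivFun D _ + _ • fracDerivFun D _
      rw [h, fracDerivFun_div D _ _ (mul_ne_zero hb0 hd0), fracDerivFun_div D _ _ hb0,
        fracDerivFun_div D _ _ hd0]
      simp only [map_add, map_mul, map_sub, Derivation.leibniz, smul_eq_mul]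
      field_simp
      ring)

theorem fracDeriv_algebraMap {R : Type*} [CommRing R] [IsDomain R] [Algebra ℂ R]
    (D : Derivation ℂ R R) (a : R) :
    fracDeriv D (algebraMap R (FractionRing R) a) = algebraMap R (FractionRing R) (D a) := by
  have h := fracDerivFun_div D a 1 one_ne_zero
  change fracDerivFun D _ = _
  simpa using h

instance instIsDomainMvPowerSeries (n : ℕ) : IsDomain (MvPowerSeries (Fin n) ℂ) :=
  NoZeroDivisors.to_isDomain _

/-- The linear vector field `A x`, with components in `ℂ[[x₁, …, xₙ]]`. -/
def linearField {n : ℕ} (A : Matrix (Fin n) (Fin n) ℂ) :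
    Fin n → MvPowerSeries (Fin n) ℂ :=
  fun k => ∑ j, MvPowerSeries.C (A k j) * MvPowerSeries.X j

/-- All components are power series without constant or linear terms. -/
def NoConstOrLinearTerms {n : ℕ} (X : Fin n → MvPowerSeries (Fin n) ℂ) : Prop :=
  ∀ (k : Fin n) (α : Fin n →₀ ℕ), α.degree < 2 → MvPowerSeries.coeff α (X k) = 0

/-- The system `ẋ = diag(l) x + X(x)` is in Poincaré–Dulac normal form: every monomial `x ^ α`
occurring in the `k`-th component of `X` is resonant, i.e. `⟨l, α⟩ = l k`. -/
def IsNormalForm {n : ℕ} (l : Fin n → ℂ) (X : Fin n → MvPowerSeries (Fin n) ℂ) : Prop :=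
  ∀ (k : Fin n) (α : Fin n →₀ ℕ), MvPowerSeries.coeff α (X k) ≠ 0 →
    (∑ i, l i * (α i : ℂ)) - l k = 0

/-- The derivation `f ↦ ∑ i, F i * ∂f/∂xᵢ` of `ℂ[[x₁, …, xₙ]]` along a formal vector field `F`. -/
def lieDeriv {n : ℕ} (F : Fin n → MvPowerSeries (Fin n) ℂ) :
    Derivation ℂ (MvPowerSeries (Fin n) ℂ) (MvPowerSeries (Fin n) ℂ) :=
  ∑ i, F i • MvPowerSeries.pderiv ℂ i

/-- `f` is a formal first integral of `ẋ = F(x)`. -/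
def IsFormalFirstIntegral {n : ℕ} (F : Fin n → MvPowerSeries (Fin n) ℂ)
    (f : MvPowerSeries (Fin n) ℂ) : Prop :=
  lieDeriv F f = 0

/-- The Laurent monomial `x ^ α`, `α ∈ ℤⁿ`, as an element of the field of fractions of
`ℂ[[x₁, …, xₙ]]`. -/
def laurentMonomial {n : ℕ} (α : Fin n → ℤ) : FractionRing (MvPowerSeries (Fin n) ℂ) :=
  ∏ i, (algebraMap (MvPowerSeries (Fin n) ℂ) (FractionRing (MvPowerSeries (Fin n) ℂ))
    (MvPowerSeries.X i)) ^ (α i)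

/-- The Laurent monomial `x ^ α` is a first integral of `ẋ = F(x)`. -/
def IsLaurentMonomialFirstIntegral {n : ℕ} (F : Fin n → MvPowerSeries (Fin n) ℂ)
    (α : Fin n → ℤ) : Prop :=
  fracDeriv (lieDeriv F) (laurentMonomial α) = 0

/-- Functional independence of formal power series `f₁, …, f_p`: their gradients are linearly
independent over the field of fractions of `ℂ[[x₁, …, xₙ]]`, i.e. the Jacobian matrix
`(∂f_j/∂xᵢ)` has rank `p`. -/
def FunctionallyIndependent {n p : ℕ} (f : Fin p → MvPowerSeries (Fin n) ℂ) : Prop :=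
  LinearIndependent (FractionRing (MvPowerSeries (Fin n) ℂ))
    (fun (j : Fin p) (i : Fin n) =>
      algebraMap (MvPowerSeries (Fin n) ℂ) (FractionRing (MvPowerSeries (Fin n) ℂ))
        (MvPowerSeries.pderiv ℂ i (f j)))

/-- The homomorphism `φ : ℤⁿ → ℂ`, `φ(x) = ⟨l, x⟩`. -/
def phi {n : ℕ} (l : Fin n → ℂ) : (Fin n → ℤ) →ₗ[ℤ] ℂ where
  toFun x := ∑ i, l i * (x i : ℂ)
  map_add' x y := by simp [mul_add, Finset.sum_add_distrib]
  map_smul' c x := by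
    simp only [Pi.smul_apply, smul_eq_mul, Int.cast_mul, RingHom.id_apply, zsmul_eq_mul,
      Finset.mul_sum]
    exact Finset.sum_congr rfl fun i _ => by ring

/-- The monoid `{α ∈ ℕ₀ⁿ : ⟨l, α⟩ = 0}`, viewed inside `ℤⁿ`. -/
def monoidM {n : ℕ} (l : Fin n → ℂ) : AddSubmonoid (Fin n → ℤ) where
  carrier := {α | (∀ i, 0 ≤ α i) ∧ ∑ i, l i * (α i : ℂ) = 0}
  zero_mem' := by simp
  add_mem' := by
    rintro a b ⟨ha, ha'⟩ ⟨hb, hb'⟩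
    refine ⟨fun i => add_nonneg (ha i) (hb i), ?_⟩
    simp [mul_add, Finset.sum_add_distrib, ha', hb']

/-- The `ℤ`-submodule of `ℤⁿ` spanned by `{α ∈ ℕ₀ⁿ : ⟨l, α⟩ = 0}`. -/
def moduleR {n : ℕ} (l : Fin n → ℂ) : Submodule ℤ (Fin n → ℤ) :=
  Submodule.span ℤ (monoidM l : Set (Fin n → ℤ))

end FormalSystem

end

/-! Over the fraction field K put θᵢ = xᵢ∂ᵢ and w = (Fᵢ/xᵢ). A series f is a first integral iff
(θᵢf) ⬝ w = 0, and x^α is one iff α ⬝ w = 0, so both conditions are orthogonality to the same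
vector. Multiplying the i-th coordinate by xᵢ preserves independence of gradients. In normal form,
first integrals have only resonant exponents (`coeff_eq_zero_of_isFormalFirstIntegral`), so their
Euler gradients lie in the K-span of R_λ (`eulerGrad_mem_span`). That span has dimension p and, by
equality of ranks, equals the K-span of ker φ. Hence p independent first integrals span it, and
every α in ker φ is orthogonal to w. Conversely, M_λ contains p vectors independent over K, and
their monomials are the required integrals. -/

namespace FormalSystem

open MvPowerSeries Finsupp

/-! ### Integer lattices after extension of scalars -/

/-- Reading integer vectors in a field. -/
noncomputable def intCastVec (K ι : Type*) [Field K] : (ι → ℤ) →ₗ[ℤ] (ι → K) :=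
  (Int.castAddHom K).toIntLinearMap.compLeft ι

@[simp]
theorem intCastVec_apply {K ι : Type*} [Field K] (α : ι → ℤ) (i : ι) :
    intCastVec K ι α i = (α i : K) := rfl

theorem span_intCastVec_span {K ι : Type*} [Field K] (s : Set (ι → ℤ)) :
    Submodule.span K (intCastVec K ι '' Submodule.span ℤ s) =
      Submodule.span K (intCastVec K ι '' s) := by
  rw [← Submodule.map_coe, Submodule.map_span, Submodule.span_span_of_tower]

theorem _root_.LinearIndependent.intCastVec (K : Type*) {ι κ : Type*} [Field K] [CharZero K]
    [Finite ι] {v : κ → ι → ℤ} (hv : LinearIndependent ℤ v) :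
    LinearIndependent K fun k => intCastVec K ι (v k) := by
  have h : (fun k => FormalSystem.intCastVec K ι (v k)) = fun k => algebraMap ℤ K ∘ v k := by
    funext k i
    simp
  rw [h]
  exact linearIndependent_algebraMap_comp_iff.mpr hv

/-- In characteristic zero a ℤ-basis of N becomes a K-basis of its span. Sublattices of equal rank,
one inside the other, thus have the same K-span even when they differ. -/
theorem finrank_span_intCastVec {K ι : Type*} [Field K] [CharZero K] [Finite ι]
    (N : Submodule ℤ (ι → ℤ)) :
    Module.finrank K (Submodule.span K (intCastVec K ι '' N)) = Module.finrank ℤ N := by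
  obtain ⟨b⟩ : Nonempty (Module.Basis (Fin (Module.finrank ℤ N)) ℤ N) :=
    ⟨Module.finBasis ℤ N⟩
  have hb : LinearIndependent ℤ fun k => (b k : ι → ℤ) :=
    b.linearIndependent.map' N.subtype N.ker_subtype
  have hK : LinearIndependent K fun k => intCastVec K ι (b k) := hb.intCastVec K
  have hN : Submodule.span ℤ (Set.range fun k => (b k : ι → ℤ)) = N := by
    have h := congrArg (Submodule.map N.subtype) b.span_eq
    rwa [Submodule.map_span, ← Set.range_comp, Submodule.map_subtype_top] at h
  have hcard := finrank_span_eq_card hK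
  rw [Fintype.card_fin] at hcard
  rw [← hcard]
  conv_lhs => rw [← hN, span_intCastVec_span, ← Set.range_comp]
  rfl

/-! ### First integrals as orthogonality relations -/

theorem leibniz_prod_zpow {K ι : Type*} [Field K] [Algebra ℂ K] (d : Derivation ℂ K K)
    (y : ι → K) (hy : ∀ i, y i ≠ 0) (a : ι → ℤ) (s : Finset ι) :
    d (∏ i ∈ s, y i ^ a i) = (∏ i ∈ s, y i ^ a i) * ∑ i ∈ s, (a i : K) * (d (y i) / y i) := by
  classical
  induction s using Finset.induction_on with
  | empty => simp
  | insert i s hi ih =>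
    rw [Finset.prod_insert hi, Finset.sum_insert hi, Derivation.leibniz, ih,
      Derivation.leibniz_zpow, zpow_sub_one₀ (hy i)]
    simp only [smul_eq_mul, zsmul_eq_mul]
    field_simp [hy i]
    ring

section

variable {n : ℕ}

theorem lieDeriv_apply (F : Fin n → MvPowerSeries (Fin n) ℂ) (f : MvPowerSeries (Fin n) ℂ) :
    lieDeriv F f = ∑ i, F i * pderiv ℂ i f := by
  rw [lieDeriv, ← Derivation.coeFnAddMonoidHom_apply, map_sum, Finset.sum_apply]
  rfl

theorem lieDeriv_X (F : Fin n → MvPowerSeries (Fin n) ℂ) (i : Fin n) :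
    lieDeriv F (MvPowerSeries.X i) = F i := by
  simp [lieDeriv_apply, pderiv_X, Pi.single_apply]

theorem algebraMap_X_ne_zero (i : Fin n) :
    algebraMap (MvPowerSeries (Fin n) ℂ) (FractionRing (MvPowerSeries (Fin n) ℂ))
      (MvPowerSeries.X i) ≠ 0 := by
  have : (MvPowerSeries.X i : MvPowerSeries (Fin n) ℂ) ≠ 0 := by
    intro h
    simpa using congrArg (MvPowerSeries.coeff (single i 1)) h
  simpa using this

/-- The logarithmic components `Fᵢ / xᵢ` of a formal vector field. -/
noncomputable def logField (F : Fin n → MvPowerSeries (Fin n) ℂ) (i : Fin n) :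
    FractionRing (MvPowerSeries (Fin n) ℂ) :=
  algebraMap (MvPowerSeries (Fin n) ℂ) _ (F i) /
    algebraMap (MvPowerSeries (Fin n) ℂ) _ (MvPowerSeries.X i)

/-- The gradient with respect to the Euler operators `xᵢ ∂/∂xᵢ`. -/
noncomputable def eulerGrad (f : MvPowerSeries (Fin n) ℂ) (i : Fin n) :
    FractionRing (MvPowerSeries (Fin n) ℂ) :=
  algebraMap _ _ (MvPowerSeries.X i * pderiv ℂ i f)

/-- The logarithmic derivative of x^α along F is Σ αᵢFᵢ/xᵢ, and x^α is invertible in K. -/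
theorem isLaurentMonomialFirstIntegral_iff (F : Fin n → MvPowerSeries (Fin n) ℂ)
    (α : Fin n → ℤ) :
    IsLaurentMonomialFirstIntegral F α ↔ intCastVec (FractionRing (MvPowerSeries (Fin n) ℂ)) (Fin n) α ⬝ᵥ logField F = 0 := by
  unfold IsLaurentMonomialFirstIntegral laurentMonomial
  rw [leibniz_prod_zpow _ _ algebraMap_X_ne_zero, mul_eq_zero_iff_left]
  · simp only [fracDeriv_algebraMap, lieDeriv_X]
    rfl
  · exact Finset.prod_ne_zero_iff.mpr fun i _ => zpow_ne_zero _ (algebraMap_X_ne_zero i)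

theorem isFormalFirstIntegral_iff (F : Fin n → MvPowerSeries (Fin n) ℂ)
    (f : MvPowerSeries (Fin n) ℂ) :
    IsFormalFirstIntegral F f ↔ eulerGrad f ⬝ᵥ logField F = 0 := by
  rw [IsFormalFirstIntegral, lieDeriv_apply,
    ← (IsFractionRing.injective (MvPowerSeries (Fin n) ℂ)
      (FractionRing (MvPowerSeries (Fin n) ℂ))).eq_iff, map_sum, map_zero]
  refine Eq.congr (Finset.sum_congr rfl fun i _ => ?_) rfl
  have := algebraMap_X_ne_zero i
  simp only [eulerGrad, logField, map_mul]
  field_simp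

theorem functionallyIndependent_iff {p : ℕ} (f : Fin p → MvPowerSeries (Fin n) ℂ) :
    FunctionallyIndependent f ↔
      LinearIndependent (FractionRing (MvPowerSeries (Fin n) ℂ)) fun j => eulerGrad (f j) := by
  let e := LinearEquiv.piCongrRight fun i : Fin n =>
    LinearEquiv.smulOfNeZero (FractionRing (MvPowerSeries (Fin n) ℂ))
      (FractionRing (MvPowerSeries (Fin n) ℂ)) _ (algebraMap_X_ne_zero i)
  have h : (fun j => eulerGrad (f j)) = e ∘ fun (j : Fin p) (i : Fin n) =>
      algebraMap (MvPowerSeries (Fin n) ℂ) (FractionRing (MvPowerSeries (Fin n) ℂ))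
        (MvPowerSeries.pderiv ℂ i (f j)) := by
    funext j i
    simp [e, eulerGrad]
  rw [h]
  exact (LinearMap.linearIndependent_iff_of_injOn e.toLinearMap e.injective.injOn).symm

/-! ### Resonant exponents -/

theorem coeff_X_mul_pderiv (f : MvPowerSeries (Fin n) ℂ) (i : Fin n) (α : Fin n →₀ ℕ) :
    coeff α (MvPowerSeries.X i * pderiv ℂ i f) = α i * coeff α f := by
  classical
  rw [MvPowerSeries.X, coeff_monomial_mul]
  split_ifs with h
  · have hi : 1 ≤ α i := by simpa using h i
    rw [coeff_pderiv, tsub_add_cancel_of_le h]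
    simp [Nat.cast_sub hi, mul_comm]
  · have hi : α i = 0 := by
      by_contra hi
      exact h (by simpa [Nat.one_le_iff_ne_zero] using hi)
    simp [hi]

theorem linearField_diagonal (l : Fin n → ℂ) (i : Fin n) :
    linearField (Matrix.diagonal l) i = C (l i) * MvPowerSeries.X i := by
  simp [linearField, Matrix.diagonal_apply, apply_ite, ite_mul]

theorem coeff_lieDeriv_linearField (l : Fin n → ℂ) (f : MvPowerSeries (Fin n) ℂ)
    (α : Fin n →₀ ℕ) :
    coeff α (lieDeriv (linearField (Matrix.diagonal l)) f) = (∑ i, l i * α i) * coeff α f := by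
  simp_rw [lieDeriv_apply, linearField_diagonal, map_sum, mul_assoc, coeff_C_mul,
    coeff_X_mul_pderiv, Finset.sum_mul, mul_assoc]

/-- Induction on |α|. A term of X_k ∂ₖf at x^α with α = β + γ involves the coefficient of f at γ +
eₖ. This exponent has the weight of α because β is resonant, and smaller degree because |β| ≥ 2. So
only the linear part contributes, multiplying the coefficient at α by ⟨λ, α⟩. -/
theorem coeff_eq_zero_of_isFormalFirstIntegral {l : Fin n → ℂ}
    {X : Fin n → MvPowerSeries (Fin n) ℂ} (hX : NoConstOrLinearTerms X) (hNF : IsNormalForm l X)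
    {f : MvPowerSeries (Fin n) ℂ}
    (hf : IsFormalFirstIntegral (linearField (Matrix.diagonal l) + X) f) (α : Fin n →₀ ℕ)
    (hα : ∑ i, l i * (α i : ℂ) ≠ 0) : coeff α f = 0 := by
  classical
  induction hd : α.degree using Nat.strong_induction_on generalizing α with
  | _ d ih =>
    have h0 : coeff α (lieDeriv X f) = 0 := by
      simp only [lieDeriv_apply, map_sum, MvPowerSeries.coeff_mul]
      refine Finset.sum_eq_zero fun k _ => Finset.sum_eq_zero fun ⟨β, γ⟩ hβγ => ?_
      rw [Finset.HasAntidiagonal.mem_antidiagonal] at hβγ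
      by_cases hβ : coeff β (X k) = 0
      · simp [hβ]
      have hβ2 : 2 ≤ β.degree := by
        by_contra h
        exact hβ (hX k β (by omega))
      have hw := hNF k β hβ
      have hγ : coeff (γ + single k 1) f = 0 := by
        refine ih (γ + single k 1).degree ?_ _ ?_ rfl
        · have := congrArg Finsupp.degree hβγ
          simp only [map_add, degree_single] at this ⊢
          omega
        · have h1 : ∑ i, l i * ((single k 1 : Fin n →₀ ℕ) i : ℂ) = l k := by
            simp [single_apply]
          have h2 : ∑ i, l i * ((γ + single k 1 : Fin n →₀ ℕ) i : ℂ) = ∑ i, l i * (α i : ℂ) := by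
            simp only [← hβγ, Finsupp.add_apply, Nat.cast_add, mul_add, Finset.sum_add_distrib,
              h1]
            linear_combination -hw
          rwa [h2]
      rw [coeff_pderiv, hγ]
      simp
    have h : coeff α (lieDeriv (linearField (Matrix.diagonal l) + X) f) = 0 := by
      rw [hf, map_zero]
    have hsum : lieDeriv (linearField (Matrix.diagonal l) + X) f =
        lieDeriv (linearField (Matrix.diagonal l)) f + lieDeriv X f := by
      simp [lieDeriv_apply, add_mul, Finset.sum_add_distrib]
    rw [hsum, map_add, h0, add_zero, coeff_lieDeriv_linearField] at h
    exact (mul_eq_zero.mp h).resolve_left hα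

/-- Expanding each exponent of f in a finite ℤ-basis of N and collecting by basis vector turns the
infinite sum into finitely many series `h m`, which serve as K-coefficients. -/
theorem eulerGrad_mem_span (N : Submodule ℤ (Fin n → ℤ)) (f : MvPowerSeries (Fin n) ℂ)
    (hf : ∀ α : Fin n →₀ ℕ, coeff α f ≠ 0 → (fun i => (α i : ℤ)) ∈ N) :
    eulerGrad f ∈ Submodule.span (FractionRing (MvPowerSeries (Fin n) ℂ))
      (intCastVec (FractionRing (MvPowerSeries (Fin n) ℂ)) (Fin n) '' N) := by
  classical
  have b := Module.finBasis ℤ N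
  -- The value 0 off N is harmless: f has no such exponents.
  let h (m : Fin (Module.finrank ℤ N)) : MvPowerSeries (Fin n) ℂ := fun α =>
    if hα : (fun i => (α i : ℤ)) ∈ N then coeff α f * (b.repr ⟨_, hα⟩ m : ℂ) else 0
  have hcoeff (m : Fin (Module.finrank ℤ N)) (α : Fin n →₀ ℕ) : coeff α (h m) =
    if hα : (fun i => (α i : ℤ)) ∈ N then coeff α f * (b.repr ⟨_, hα⟩ m : ℂ) else 0 := rfl
  have key (i : Fin n) : MvPowerSeries.X i * pderiv ℂ i f =
      ∑ m, C ((b m).1 i : ℂ) * h m := by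
    ext α
    simp only [coeff_X_mul_pderiv, map_sum, coeff_C_mul, hcoeff]
    by_cases hα : (fun i => (α i : ℤ)) ∈ N
    · have hr := congrArg (fun v : N => ((v.1 i : ℤ) : ℂ)) (b.sum_repr ⟨_, hα⟩)
      simp only [AddSubmonoidClass.coe_finsetSum, Submodule.coe_smul, Finset.sum_apply,
        Pi.smul_apply, smul_eq_mul, Int.cast_sum, Int.cast_mul, Int.cast_natCast] at hr
      simp only [hα, dif_pos, ← hr, Finset.sum_mul]
      exact Finset.sum_congr rfl fun m _ => by ring
    · have : coeff α f = 0 := by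
        by_contra h0
        exact hα (hf α h0)
      simp [hα, this]
  have : eulerGrad f = ∑ m, algebraMap _ (FractionRing (MvPowerSeries (Fin n) ℂ)) (h m) •
      intCastVec (FractionRing (MvPowerSeries (Fin n) ℂ)) (Fin n) (b m) := by
    funext i
    simp only [eulerGrad, key, map_sum, map_mul, Finset.sum_apply, Pi.smul_apply, smul_eq_mul,
      intCastVec_apply, map_intCast]
    exact Finset.sum_congr rfl fun m _ => mul_comm _ _
  rw [this]
  exact sum_mem fun m _ => Submodule.smul_mem _ _ (Submodule.subset_span ⟨_, (b m).2, rfl⟩)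

theorem isLaurentMonomialFirstIntegral_linearField_iff (l : Fin n → ℂ) (α : Fin n → ℤ) :
    IsLaurentMonomialFirstIntegral (linearField (Matrix.diagonal l)) α ↔
      α ∈ LinearMap.ker (phi l) := by
  have h (i : Fin n) : logField (linearField (Matrix.diagonal l)) i =
      algebraMap (MvPowerSeries (Fin n) ℂ) _ (C (l i)) := by
    rw [logField, linearField_diagonal, map_mul, mul_div_cancel_right₀ _ (algebraMap_X_ne_zero i)]
  have h2 : intCastVec (FractionRing (MvPowerSeries (Fin n) ℂ)) (Fin n) α ⬝ᵥ logField (linearField (Matrix.diagonal l)) =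
      algebraMap (MvPowerSeries (Fin n) ℂ) _ (C (phi l α)) := by
    simp [dotProduct, h, phi, mul_comm]
  rw [isLaurentMonomialFirstIntegral_iff, h2, LinearMap.mem_ker]
  simp

theorem eulerGrad_monomial (α : Fin n →₀ ℕ) :
    eulerGrad (monomial α (1 : ℂ)) = algebraMap _ (FractionRing (MvPowerSeries (Fin n) ℂ)) (monomial α (1 : ℂ)) •
      intCastVec (FractionRing (MvPowerSeries (Fin n) ℂ)) (Fin n) (fun i => (α i : ℤ)) := by
  classical
  funext i
  have : MvPowerSeries.X i * pderiv ℂ i (monomial α (1 : ℂ)) =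
      monomial α (1 : ℂ) * C (α i : ℂ) := by
    ext β
    rw [coeff_X_mul_pderiv, coeff_mul_C, coeff_monomial]
    split_ifs with h
    · simp [h]
    · simp
  simp [eulerGrad, this]

end

end FormalSystem

/-! ### The equivalence -/

open FormalSystem MvPowerSeries in
theorem mainTheorem2 (n p : ℕ) (l : Fin n → ℂ) (X : Fin n → MvPowerSeries (Fin n) ℂ)
    (hX : FormalSystem.NoConstOrLinearTerms X)
    (hker : Module.finrank ℤ (LinearMap.ker (FormalSystem.phi l)) = p)
    (hR : Module.finrank ℤ (FormalSystem.moduleR l) = p)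
    (hNF : FormalSystem.IsNormalForm l X) :
    (∃ f : Fin p → MvPowerSeries (Fin n) ℂ,
        (∀ j, FormalSystem.IsFormalFirstIntegral
          (FormalSystem.linearField (Matrix.diagonal l) + X) (f j)) ∧
        FormalSystem.FunctionallyIndependent f) ↔
      ∀ α : Fin n → ℤ,
        FormalSystem.IsLaurentMonomialFirstIntegral
          (FormalSystem.linearField (Matrix.diagonal l)) α →
        FormalSystem.IsLaurentMonomialFirstIntegral
          (FormalSystem.linearField (Matrix.diagonal l) + X) α := by
  let K := FractionRing (MvPowerSeries (Fin n) ℂ)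
  have : CharZero K := charZero_of_injective_algebraMap (FaithfulSMul.algebraMap_injective ℂ K)
  have hM_le : (monoidM l : Set (Fin n → ℤ)) ⊆ LinearMap.ker (phi l) := fun α hα => hα.2
  have hle : moduleR l ≤ LinearMap.ker (phi l) := Submodule.span_le.mpr hM_le
  have hspan : Submodule.span K (intCastVec K (Fin n) '' moduleR l) =
      Submodule.span K (intCastVec K (Fin n) '' LinearMap.ker (phi l)) :=
    Submodule.eq_of_le_of_finrank_eq (Submodule.span_mono (Set.image_mono hle))
      (by rw [finrank_span_intCastVec, finrank_span_intCastVec, hR, hker])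
  simp_rw [isLaurentMonomialFirstIntegral_linearField_iff, functionallyIndependent_iff]
  constructor
  · rintro ⟨f, hf, hind⟩ α hα
    rw [isLaurentMonomialFirstIntegral_iff]
    have hmem (j : Fin p) : eulerGrad (f j) ∈
        Submodule.span K (intCastVec K (Fin n) '' moduleR l) := by
      refine eulerGrad_mem_span _ _ fun β hβ => Submodule.subset_span ⟨fun i => by simp, ?_⟩
      by_contra h
      exact hβ (coeff_eq_zero_of_isFormalFirstIntegral hX hNF (hf j) β (by simpa using h))
    have heq : Submodule.span K (Set.range fun j => eulerGrad (f j)) =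
        Submodule.span K (intCastVec K (Fin n) '' moduleR l) := by
      refine Submodule.eq_of_le_of_finrank_eq
        (Submodule.span_le.mpr (Set.range_subset_iff.mpr hmem)) ?_
      rw [finrank_span_eq_card hind, Fintype.card_fin, finrank_span_intCastVec, hR]
    have hα' : intCastVec K (Fin n) α ∈ Submodule.span K (Set.range fun j => eulerGrad (f j)) := by
      rw [heq, hspan]
      exact Submodule.subset_span ⟨α, hα, rfl⟩
    -- Orthogonality to `logField` is linear, so it suffices to check it on the Euler gradients.
    generalize intCastVec K (Fin n) α = v at hα' ⊢
    induction hα' using Submodule.span_induction with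
    | mem x hx =>
      obtain ⟨j, rfl⟩ := hx
      exact (isFormalFirstIntegral_iff _ _).mp (hf j)
    | zero => exact zero_dotProduct _
    | add x y _ _ hx hy => rw [add_dotProduct, hx, hy, add_zero]
    | smul c x _ hx => rw [smul_dotProduct, hx, smul_zero]
  · intro h
    have hspanM : Submodule.span K (intCastVec K (Fin n) '' monoidM l) =
        Submodule.span K (intCastVec K (Fin n) '' moduleR l) :=
      (span_intCastVec_span _).symm
    -- A K-basis of the span is drawn from M_λ itself, so its exponents are nonnegative and give
    -- genuine power series.
    obtain ⟨v, hv, -, hind⟩ := Submodule.exists_fun_fin_finrank_span_eq K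
      (intCastVec K (Fin n) '' (monoidM l : Set (Fin n → ℤ)))
    have hcard : Module.finrank K (Submodule.span K (intCastVec K (Fin n) '' monoidM l)) = p := by
      rw [hspanM, finrank_span_intCastVec, hR]
    choose β hβ hβv using hv
    have hcast (j) : ∃ γ : Fin n →₀ ℕ, β j = fun i => (γ i : ℤ) :=
      ⟨Finsupp.equivFunOnFinite.symm fun i => (β j i).toNat, by
        funext i
        simp [(hβ j).1 i]⟩
    choose γ hγ using hcast
    have hgrad (j) : eulerGrad (monomial (γ j) (1 : ℂ)) =
        algebraMap _ K (monomial (γ j) (1 : ℂ)) • v j := by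
      rw [eulerGrad_monomial, ← hγ, hβv]
    refine ⟨fun j => monomial (γ (finCongr hcard.symm j)) 1, fun j => ?_, ?_⟩
    · have hD := (isLaurentMonomialFirstIntegral_iff _ _).mp
        (h _ (hM_le (hβ (finCongr hcard.symm j))))
      rw [isFormalFirstIntegral_iff, hgrad, smul_dotProduct, ← hβv, hD, smul_zero]
    · simp_rw [hgrad]
      have hne (j) : algebraMap (MvPowerSeries (Fin n) ℂ) K (monomial (γ j) (1 : ℂ)) ≠ 0 := by
        intro h0
        have h1 : monomial (γ j) (1 : ℂ) = 0 := by simpa using h0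
        simpa using congrArg (coeff (γ j)) h1
      -- Each Euler gradient is a nonzero multiple, by the monomial itself, of a vector of this
      -- basis.
      exact (hind.comp _ (finCongr hcard.symm).injective).units_smul
        fun j => Units.mk0 _ (hne (finCongr hcard.symm j))
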